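/- All graphs are finite simple undirected graphs $G=(V(G),E(G))$; the union of graphs is the union of vertex sets and of edge sets. A clique of $G$ is a complete subgraph of $G$, and it is maximal if it is not a proper subgraph of another clique of $G$. A set $A\subseteq V(G)$ is the inner hub of $G$ if $V(K)\cap V(L)=A$ for any two distinct maximal cliques $K,L$ of $G$, and $A=V(G)$ if $G$ is complete. Two graphs $G$, $H$ are glued on a clique if there is a graph $K$ that is a maximal clique of both $G$ and $H$ and $V(G)\cap V(H)=V(K)$. Let $S_1$ be a graph with inner hub $A_1$, and let $S_{11},\dots,S_{1l}$ be its maximal cliques. Let $E\subseteq\{2,\dots,l\}$ (possibly empty) and, for every $\alpha\in E$, let $S_\alpha$ be a graph with inner hub $A_\alpha\neq\emptyset$ such that $A_\alpha\cap A_1=\emptyset$. Put $G=\bigcup_{\alpha\in E\cup\{1\}}S_\alpha$, let $m=|V(G)|$ and $V(G)=\{v_1,\dots,v_m\}$. Let $X_1,\dots,X_m\subseteq\mathbb R^n$ be open and bounded, and let $\mu_i$ be a Borel probability measure on $X_i$, $i=1,\dots,m$. Assume: 1. $S_\alpha$ and $S_1$ are glued on a clique, for every $\alpha\in E$; 2.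 $V(S_\alpha)\cap V(S_\beta)=A_1$ for all $\alpha\neq\beta$ in $E$; 3. for every $\alpha\in E\cup\{1\}$ there is an index $p_\alpha$ with $v_{p_\alpha}\in A_\alpha$ such that $\mu_{p_\alpha}$ is absolutely continuous with respect to the Lebesgue measure $\mathcal L^n$; 4. $\mu_1$ is absolutely continuous with respect to $\mathcal L^n$, and $v_1\in V(S_{11})$. Let $$b(x_1,\dots,x_m)=\sum_{\{v_i,v_j\}\in E(G)}x_i\cdot x_j .$$ Then every Borel probability measure $\gamma$ on $X_1\times\dots\times X_m$ that maximizes $\int b\,d\gamma$ among all Borel probability measures on $X_1\times\dots\times X_m$ with marginals $\mu_1,\dots,\mu_m$ is concentrated on the graph of a measurable map $T=(T_2,\dots,T_m):X_1\to X_2\times\dots\times X_m$. -/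

import Mathlib

open MeasureTheory

namespace GraphOT

/-- A simple graph `(V(G), E(G))` whose vertex set is a subset of the ambient vertex set `V`.
Such a graph is the same thing as a subgraph of the complete graph on `V`; its vertices are
`G.verts`, its adjacency relation is `G.Adj`, and `⊔`, `⨆` are unions of graphs (vertices and
edges). -/
abbrev Graph (V : Type*) := (⊤ : SimpleGraph V).Subgraph

/-- `K` is the vertex set of a clique (complete subgraph) of `G`. A complete subgraph is determined
by its vertex set. -/
def IsCliqueOf {V : Type*} (G : Graph V) (K : Set V) : Prop :=
  K ⊆ G.verts ∧ G.spanningCoe.IsClique K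

/-- `K` is the vertex set of a maximal clique of `G`. -/
def IsMaxCliqueOf {V : Type*} (G : Graph V) (K : Set V) : Prop :=
  Maximal (IsCliqueOf G) K

/-- `A` is the inner hub of `G`: any two different maximal cliques of `G` meet exactly in `A`;
the inner hub of a complete graph (a graph with a single maximal clique) is its whole vertex
set. -/
def IsInnerHub {V : Type*} (G : Graph V) (A : Set V) : Prop :=
  (∀ K L : Set V, IsMaxCliqueOf G K → IsMaxCliqueOf G L → K ≠ L → K ∩ L = A) ∧
    (IsCliqueOf G G.verts → A = G.verts)

/-- `G` and `H` are glued on a clique: they have a common maximal clique, and the vertices of this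
clique are exactly the common vertices of `G` and `H`. -/
def GluedOnClique {V : Type*} (G H : Graph V) : Prop :=
  ∃ K : Set V, IsMaxCliqueOf G K ∧ IsMaxCliqueOf H K ∧ G.verts ∩ H.verts = K

/-- The scalar product `x_i · x_j` as a function of the unordered pair `{i, j}`. -/
noncomputable def edgeProd {V : Type*} {n : ℕ} (x : V → EuclideanSpace ℝ (Fin n)) :
    Sym2 V → ℝ :=
  Sym2.lift ⟨fun i j => inner ℝ (x i) (x j), fun i j => real_inner_comm (x j) (x i)⟩

open Classical in
/-- The surplus `b(x) = ∑_{ {i,j} ∈ E(G) } x_i · x_j` associated with the graph `G`. -/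
noncomputable def surplus {V : Type*} [Fintype V] {n : ℕ} (G : Graph V)
    (x : V → EuclideanSpace ℝ (Fin n)) : ℝ :=
  ∑ e : Sym2 V with e ∈ G.edgeSet, edgeProd x e

/-- `γ` is admissible in the Kantorovich problem: a Borel probability measure on the product of the
sets `X i` whose marginals are the `μ i`. -/
structure IsPlan {V : Type*} [Fintype V] {n : ℕ} (X : V → Set (EuclideanSpace ℝ (Fin n)))
    (μ : V → Measure (EuclideanSpace ℝ (Fin n)))
    (γ : Measure (V → EuclideanSpace ℝ (Fin n))) : Prop where
  isProbabilityMeasure : IsProbabilityMeasure γ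
  concentrated : γ (Set.univ.pi X)ᶜ = 0
  marginal : ∀ i, γ.map (fun x => x i) = μ i

/-- `γ` solves the Kantorovich problem with surplus `b`: it maximizes `∫ b` among admissible
measures. (In the use below the `X i` are bounded and `b` is continuous, so all the integrals
are integrals of functions that are bounded almost everywhere.) -/
def IsKantorovichSolution {V : Type*} [Fintype V] {n : ℕ}
    (X : V → Set (EuclideanSpace ℝ (Fin n))) (μ : V → Measure (EuclideanSpace ℝ (Fin n)))
    (b : (V → EuclideanSpace ℝ (Fin n)) → ℝ)
    (γ : Measure (V → EuclideanSpace ℝ (Fin n))) : Prop :=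
  IsPlan X μ γ ∧ ∀ γ', IsPlan X μ γ' → ∫ x, b x ∂γ' ≤ ∫ x, b x ∂γ

/-- `γ` is concentrated on the graph of a measurable map `T = (T_i)_{i ≠ v}` from `X v` to the
product of the other `X i`. (As `X v` is a Borel set when the definition is used, `T` may be
taken Borel on the whole space.) -/
def ConcentratedOnMap {V : Type*} [Fintype V] {n : ℕ}
    (X : V → Set (EuclideanSpace ℝ (Fin n))) (v : V)
    (γ : Measure (V → EuclideanSpace ℝ (Fin n))) : Prop :=
  ∃ T : EuclideanSpace ℝ (Fin n) → {i : V // i ≠ v} → EuclideanSpace ℝ (Fin n),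
    Measurable T ∧ (∀ y ∈ X v, ∀ i : {i : V // i ≠ v}, T y i ∈ X i) ∧
      ∀ᵐ x ∂γ, ∀ i : {i : V // i ≠ v}, x i = T (x v) i

end GraphOT

/-! The support of a maximizer is monotone: rearranging finitely many of its points coordinate by
coordinate cannot raise the total surplus (`IsKantorovichSolution.rearrangementMonotone_support`).
By `concentratedOnMap_of_injOn` it suffices that, on a Borel set of full measure, two points `x`,
`y` with the same coordinate at `v₁` coincide. Monotonicity is used only through two properties of
`d = x - y`, collected in `IsRigid`.

Cut: exchanging the coordinates off a vertex set `P` shows that the sum of `⟪d i, d j⟫` over the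
edges leaving `P` is nonnegative.

Branch: if `x` and `y` agree at the vertices outside `B` adjacent to `B`, their coordinates in `B`
can be exchanged at no cost. For `p ∉ B` the resulting points `z` give a cyclically monotone set of
pairs (`z p`, sum of `z` over the neighbours of `p`). By Rockafellar and Rademacher it is a graph
off a Lebesgue null set, which `μ p` does not see when it is absolutely continuous. So `d p = 0`
makes the sum of `d` over the neighbours of `p` in `B` vanish.

The rest is combinatorics. If all vertices of a set `A` have the same closed neighbourhood `W`, the
one-vertex cuts add up to `∑_A ‖d i‖² ≤ ⟪∑_A d, ∑_W d⟫`, so `d = 0` on `A` as soon as one of the two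
sums is zero. This applies to each hub (`W` is the vertex set of its graph) and to the non-hub
vertices of a clique (`W` is the clique). Zeros then spread from a hub to its whole graph, and
through the glued cliques to the other graphs. The delicate start is a `v₁` in no hub, on a clique
glued to some `S α`: there the sums of `d` over `A α` and `A o` are only known to be opposite, and
one more cut gives `-‖∑_{A o} d‖² ≥ 0`. -/

namespace GraphOT

/-! ### Cyclically monotone sets and Rockafellar's potential. -/

section Rockafellar

variable {F : Type*} [NormedAddCommGroup F] [InnerProductSpace ℝ F]

/-- A set of pairs is cyclically monotone if the pairing given by the set is optimal, for the
scalar product, among all rearrangements of finitely many of its elements. -/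
def CyclicallyMonotone (M : Set (F × F)) : Prop :=
  ∀ (N : ℕ) (f : Fin N → F × F), (∀ k, f k ∈ M) → ∀ σ : Equiv.Perm (Fin N),
    ∑ k, inner ℝ (f (σ k)).1 (f k).2 ≤ ∑ k, inner ℝ (f k).1 (f k).2

/-- The value at `z` of the affine function obtained from the first `n + 1` links of a chain. -/
def chainValue (m : ℕ → F × F) (n : ℕ) (z : F) : ℝ :=
  ∑ k ∈ Finset.range n, inner ℝ ((m (k + 1)).1 - (m k).1) (m k).2 +
    inner ℝ (z - (m n).1) (m n).2

lemma chainValue_sub (m : ℕ → F × F) (n : ℕ) (z z' : F) :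
    chainValue m n z - chainValue m n z' = inner ℝ (z - z') (m n).2 := by
  simp only [chainValue, inner_sub_left]
  ring

lemma CyclicallyMonotone.chainValue_le_zero {M : Set (F × F)} (hM : CyclicallyMonotone M)
    {m : ℕ → F × F} (hm : ∀ k, m k ∈ M) (n : ℕ) : chainValue m n (m 0).1 ≤ 0 := by
  -- The cyclic shift closes the chain by a link from its end back to its start.
  have h := hM (n + 1) (fun k => m k) (fun k => hm k) (finRotate (n + 1))
  have e1 : ∑ k : Fin (n + 1), inner ℝ (m (finRotate (n + 1) k)).1 (m k).2 =
      ∑ k ∈ Finset.range n, inner ℝ (m (k + 1)).1 (m k).2 + inner ℝ (m 0).1 (m n).2 := by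
    rw [Fin.sum_univ_castSucc, Finset.sum_range]
    simp
  have e2 : ∑ k : Fin (n + 1), inner ℝ (m k).1 (m k).2 =
      ∑ k ∈ Finset.range n, inner ℝ (m k).1 (m k).2 + inner ℝ (m n).1 (m n).2 := by
    rw [Fin.sum_univ_castSucc, Finset.sum_range]
    simp
  rw [e1, e2] at h
  simp only [chainValue, inner_sub_left, Finset.sum_sub_distrib]
  linarith

/-- A chain prolonged by `q` is again a chain, so this identity yields the subgradient inequality at
`q` for the supremum over all chains. -/
lemma chainValue_extend (m : ℕ → F × F) (n : ℕ) (q : F × F) (z : F) :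
    chainValue (fun k => if k ≤ n then m k else q) (n + 1) z =
      chainValue m n q.1 + inner ℝ (z - q.1) q.2 := by
  simp only [chainValue, Finset.sum_range_succ]
  have : ∑ k ∈ Finset.range n, inner ℝ ((if k + 1 ≤ n then m (k + 1) else q).1 -
      (if k ≤ n then m k else q).1) (if k ≤ n then m k else q).2 =
      ∑ k ∈ Finset.range n, inner ℝ ((m (k + 1)).1 - (m k).1) (m k).2 := by
    refine Finset.sum_congr rfl fun k hk => ?_
    have := Finset.mem_range.1 hk
    rw [if_pos (by omega), if_pos (by omega)]
  rw [this]
  simp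

/-- Rockafellar's theorem for cyclically monotone sets with bounded second coordinates: they are
contained in the subdifferential of a Lipschitz function. -/
theorem CyclicallyMonotone.exists_lipschitz_potential {M : Set (F × F)}
    (hM : CyclicallyMonotone M) {R : NNReal} (hR : ∀ q ∈ M, ‖q.2‖ ≤ R) :
    ∃ φ : F → ℝ, LipschitzWith R φ ∧ ∀ q ∈ M, ∀ z, φ q.1 + inner ℝ (z - q.1) q.2 ≤ φ z := by
  rcases M.eq_empty_or_nonempty with rfl | ⟨q₀, hq₀⟩
  · exact ⟨fun _ => 0, LipschitzWith.const' 0, by simp⟩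
  let I := {p : (ℕ → F × F) × ℕ // (∀ k, p.1 k ∈ M) ∧ p.1 0 = q₀}
  let φ : F → ℝ := fun z => ⨆ p : I, chainValue p.1.1 p.1.2 z
  have : Nonempty I := ⟨⟨(fun _ => q₀, 0), fun _ => hq₀, rfl⟩⟩
  have hlip : ∀ (p : I) z z', chainValue p.1.1 p.1.2 z ≤
      chainValue p.1.1 p.1.2 z' + R * ‖z - z'‖ := by
    intro p z z'
    have h1 := chainValue_sub p.1.1 p.1.2 z z'
    have h2 := real_inner_le_norm (z - z') (p.1.1 p.1.2).2
    have h3 := mul_le_mul_of_nonneg_left (hR _ (p.2.1 p.1.2)) (norm_nonneg (z - z'))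
    linarith
  have hbdd : ∀ z, BddAbove (Set.range fun p : I => chainValue p.1.1 p.1.2 z) := by
    intro z
    -- Every chain is nonpositive at the common starting point and `R`-Lipschitz.
    refine ⟨R * ‖z - q₀.1‖, ?_⟩
    rintro _ ⟨p, rfl⟩
    have h0 := hM.chainValue_le_zero p.2.1 p.1.2
    rw [p.2.2] at h0
    have := hlip p z q₀.1
    simp only
    linarith
  refine ⟨φ, ?_, ?_⟩
  · refine LipschitzWith.of_le_add_mul R fun z z' => ?_
    refine ciSup_le fun p => ?_
    have := hlip p z z'
    have h2 : chainValue p.1.1 p.1.2 z' ≤ φ z' := le_ciSup (hbdd z') p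
    rw [dist_eq_norm]
    linarith
  · intro q hq z
    rw [← le_sub_iff_add_le]
    refine ciSup_le fun p => ?_
    rw [le_sub_iff_add_le, ← chainValue_extend]
    refine le_ciSup (hbdd z) (⟨(fun k => if k ≤ p.1.2 then p.1.1 k else q, p.1.2 + 1), ?_, ?_⟩ : I)
    · intro k
      dsimp only
      split_ifs
      exacts [p.2.1 k, hq]
    · simp [p.2.2]

/-- A cyclically monotone set with bounded second coordinates is a graph over the complement of a
Lebesgue null set. -/
theorem CyclicallyMonotone.exists_null_set {n : ℕ}
    {M : Set (EuclideanSpace ℝ (Fin n) × EuclideanSpace ℝ (Fin n))}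
    (hM : CyclicallyMonotone M) {R : ℝ} (hR : ∀ q ∈ M, ‖q.2‖ ≤ R) :
    ∃ N : Set (EuclideanSpace ℝ (Fin n)), volume N = 0 ∧
      ∀ q ∈ M, ∀ q' ∈ M, q.1 = q'.1 → q.1 ∉ N → q.2 = q'.2 := by
  obtain ⟨φ, hφ, hsub⟩ := hM.exists_lipschitz_potential (R := R.toNNReal)
    fun q hq => (hR q hq).trans (Real.le_coe_toNNReal R)
  -- Rademacher's theorem; where `φ` is differentiable, its only subgradient is the gradient.
  refine ⟨{x | ¬ DifferentiableAt ℝ φ x}, hφ.ae_differentiableAt, ?_⟩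
  have key : ∀ q ∈ M, ∀ D : EuclideanSpace ℝ (Fin n) →L[ℝ] ℝ, HasFDerivAt φ D q.1 →
      ∀ v, D v = inner ℝ v q.2 := by
    intro q hq D hD v
    have hm : IsLocalMin (fun z => φ z - innerSL ℝ q.2 (z - q.1)) q.1 := by
      refine Filter.Eventually.of_forall fun z => ?_
      have := hsub q hq z
      rw [real_inner_comm] at this
      simp only [innerSL_apply_apply, sub_self, inner_zero_right]
      linarith
    have h0 := hm.hasFDerivAt_eq_zero
      (hD.sub ((innerSL ℝ q.2).hasFDerivAt.comp q.1 ((hasFDerivAt_id q.1).sub_const q.1)))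
    have h1 := congrArg (fun L => L v) h0
    simp only [sub_apply, ContinuousLinearMap.comp_apply,
      innerSL_apply_apply, zero_apply, ContinuousLinearMap.id_apply] at h1
    rw [real_inner_comm]
    linarith
  intro q hq q' hq' he hN
  obtain ⟨D, hD⟩ := not_not.1 hN
  refine ext_inner_left ℝ fun v => ?_
  rw [← key q hq D hD v, ← key q' hq' D (he ▸ hD) v]

end Rockafellar

/-! ### Monotonicity of the support of a maximizer. -/

section Monotone

open ProbabilityTheory

variable {V : Type*} {n : ℕ}

/-- Rearranging finitely many points of `Γ` coordinate by coordinate does not increase the total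
surplus. -/
def RearrangementMonotone (b : (V → EuclideanSpace ℝ (Fin n)) → ℝ)
    (Γ : Set (V → EuclideanSpace ℝ (Fin n))) : Prop :=
  ∀ (N : ℕ) (f : Fin N → V → EuclideanSpace ℝ (Fin n)) (σ : V → Equiv.Perm (Fin N)),
    (∀ k, f k ∈ Γ) → ∑ k, b (fun i => f (σ i k) i) ≤ ∑ k, b (f k)

lemma RearrangementMonotone.mono {b : (V → EuclideanSpace ℝ (Fin n)) → ℝ}
    {Γ Γ' : Set (V → EuclideanSpace ℝ (Fin n))} (h : RearrangementMonotone b Γ) (hs : Γ' ⊆ Γ) :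
    RearrangementMonotone b Γ' :=
  fun N f σ hf => h N f σ fun k => hs (hf k)

/-- Other finite index types are needed later: `Bool` for two points, `Fin N × Bool` for `N` pairs.
-/
lemma RearrangementMonotone.sum_le {b : (V → EuclideanSpace ℝ (Fin n)) → ℝ}
    {Γ : Set (V → EuclideanSpace ℝ (Fin n))} (h : RearrangementMonotone b Γ)
    {ι : Type*} [Fintype ι] (f : ι → V → EuclideanSpace ℝ (Fin n)) (σ : V → Equiv.Perm ι)
    (hf : ∀ k, f k ∈ Γ) : ∑ k, b (fun i => f (σ i k) i) ≤ ∑ k, b (f k) := by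
  let e := Fintype.equivFin ι
  have := h (Fintype.card ι) (fun k => f (e.symm k)) (fun i => (e.symm.trans (σ i)).trans e)
    (fun k => hf _)
  simp only [Equiv.trans_apply, Equiv.symm_apply_apply] at this
  rwa [Equiv.sum_comp e.symm (fun k => b (fun i => f (σ i k) i)),
    Equiv.sum_comp e.symm (fun k => b (f k))] at this

variable [Fintype V]

lemma measure_compl_pi_eq_zero {X : V → Set (EuclideanSpace ℝ (Fin n))}
    {ν : Measure (V → EuclideanSpace ℝ (Fin n))} (hX : ∀ i, MeasurableSet (X i))
    (h : ∀ i, ν.map (fun x => x i) (X i)ᶜ = 0) : ν (Set.univ.pi X)ᶜ = 0 := by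
  refine measure_mono_null (t := ⋃ i, (fun x => x i) ⁻¹' (X i)ᶜ) ?_ ?_
  · intro x hx
    simpa [Set.mem_pi] using hx
  · refine measure_iUnion_null fun i => ?_
    rw [← Measure.map_apply (measurable_pi_apply i) (hX i).compl]
    exact h i

lemma integrable_of_measure_compl_pi_eq_zero {X : V → Set (EuclideanSpace ℝ (Fin n))}
    (hXbdd : ∀ i, Bornology.IsBounded (X i)) {b : (V → EuclideanSpace ℝ (Fin n)) → ℝ}
    (hb : Continuous b) {ν : Measure (V → EuclideanSpace ℝ (Fin n))} [IsFiniteMeasure ν]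
    (h : ν (Set.univ.pi X)ᶜ = 0) : Integrable b ν := by
  have hK : IsCompact (closure (Set.univ.pi X)) := (Bornology.IsBounded.pi hXbdd).isCompact_closure
  obtain ⟨C, hC⟩ := hK.exists_bound_of_continuousOn hb.continuousOn
  refine Integrable.of_bound hb.aestronglyMeasurable C ?_
  have : ∀ᵐ x ∂ν, x ∈ Set.univ.pi X := h
  filter_upwards [this] with x hx using hC x (subset_closure hx)

/-- The support of a solution of the Kantorovich problem is monotone. -/
theorem IsKantorovichSolution.rearrangementMonotone_support
    {X : V → Set (EuclideanSpace ℝ (Fin n))} (hX : ∀ i, MeasurableSet (X i))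
    (hXbdd : ∀ i, Bornology.IsBounded (X i)) {μ : V → Measure (EuclideanSpace ℝ (Fin n))}
    (hμX : ∀ i, μ i (X i)ᶜ = 0)
    {b : (V → EuclideanSpace ℝ (Fin n)) → ℝ} (hb : Continuous b)
    {γ : Measure (V → EuclideanSpace ℝ (Fin n))} (hγ : IsKantorovichSolution X μ b γ) :
    RearrangementMonotone b γ.support := by
  classical
  intro N f σ hf
  by_contra! hlt
  have := hγ.1.isProbabilityMeasure
  let R : Fin N → (Fin N → V → EuclideanSpace ℝ (Fin n)) → V → EuclideanSpace ℝ (Fin n) :=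
    fun k z i => z (σ i k) i
  have hRc : ∀ k, Continuous (R k) := fun k => by fun_prop
  have hRm : ∀ k, Measurable (R k) := fun k => (hRc k).measurable
  -- `Φ` is the gain of the rearrangement. It is positive at `f`, hence on a product of
  -- neighbourhoods `U k`, each charged by `γ` since `f k` lies in the support.
  let Φ : (Fin N → V → EuclideanSpace ℝ (Fin n)) → ℝ := fun z => ∑ k, b (R k z) - ∑ k, b (z k)
  have hΦ : Continuous Φ := by fun_prop
  obtain ⟨U, hU, hUΦ⟩ := isOpen_pi_iff'.1 (isOpen_lt continuous_const hΦ) f (sub_pos.2 hlt)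
  have hUm : ∀ k, MeasurableSet (U k) := fun k => (hU k).1.measurableSet
  have hUpos : ∀ k, γ (U k) ≠ 0 := fun k =>
    ((Measure.mem_support_iff_forall _).1 (hf k) _ ((hU k).1.mem_nhds (hU k).2)).ne'
  let ν : Fin N → Measure (V → EuclideanSpace ℝ (Fin n)) := fun k => γ[|U k]
  have hν : ∀ k, IsProbabilityMeasure (ν k) := fun k => cond_isProbabilityMeasure (hUpos k)
  let η := Measure.pi ν
  have hmarg : ∀ k i, (η.map (R k)).map (fun x => x i) = (ν (σ i k)).map (fun x => x i) := by
    intro k i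
    rw [Measure.map_map (measurable_pi_apply i) (hRm k),
      ← (measurePreserving_eval ν (σ i k)).map_eq,
      Measure.map_map (measurable_pi_apply i) (measurable_pi_apply _)]
    rfl
  have hN : N ≠ 0 := by
    rintro rfl
    simp at hlt
  -- Each `∏ j, γ (U j)` is at most `γ (U k)`, so `c • ν k ≤ N⁻¹ • γ`; summing over `k` gives `ρ ≤
  -- γ`, and `ρ` can be removed from `γ`.
  let c : ENNReal := (N : ENNReal)⁻¹ * ∏ k, γ (U k)
  have hc0 : c ≠ 0 := mul_ne_zero (by simp) (Finset.prod_ne_zero_iff.2 fun k _ => hUpos k)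
  have hctop : c ≠ ⊤ :=
    ENNReal.mul_ne_top (by simpa using hN) (ENNReal.prod_ne_top fun k _ => measure_ne_top _ _)
  let ρ := c • ∑ k, ν k
  let ρ' := c • ∑ k, η.map (R k)
  have hρm : ∀ i, ρ'.map (fun x => x i) = ρ.map (fun x => x i) := by
    intro i
    simp only [ρ, ρ', Measure.map_smul]
    congr 1
    rw [← Measure.mapₗ_apply_of_measurable (measurable_pi_apply i),
      ← Measure.mapₗ_apply_of_measurable (measurable_pi_apply i), map_sum, map_sum,
      ← Equiv.sum_comp (σ i) fun k => Measure.mapₗ (fun x : V → EuclideanSpace ℝ (Fin n) => x i)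
        (ν k)]
    refine Finset.sum_congr rfl fun k _ => ?_
    rw [Measure.mapₗ_apply_of_measurable (measurable_pi_apply i),
      Measure.mapₗ_apply_of_measurable (measurable_pi_apply i), hmarg]
  have hρle : ρ ≤ γ := by
    refine Measure.le_iff.2 fun s hs => ?_
    simp only [ρ, Measure.smul_apply, Measure.finsetSum_apply, smul_eq_mul, c]
    have h1 : ∀ k, (∏ j, γ (U j)) * ν k s ≤ γ s := by
      intro k
      have hp : ∏ j, γ (U j) ≤ γ (U k) := by
        rw [← Finset.mul_prod_erase _ _ (Finset.mem_univ k)]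
        exact mul_le_of_le_one_right' (Finset.prod_le_one' fun j _ => prob_le_one)
      calc (∏ j, γ (U j)) * ν k s ≤ γ (U k) * ((γ (U k))⁻¹ * γ (U k ∩ s)) := by
            rw [← cond_apply (hUm k)]
            gcongr
        _ = γ (U k ∩ s) := by
            rw [← mul_assoc, ENNReal.mul_inv_cancel (hUpos k) (measure_ne_top _ _), one_mul]
        _ ≤ γ s := measure_mono Set.inter_subset_right
    rw [mul_assoc, Finset.mul_sum]
    calc (N : ENNReal)⁻¹ * ∑ k, (∏ j, γ (U j)) * ν k s
        ≤ (N : ENNReal)⁻¹ * ∑ _k : Fin N, γ s := by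
          gcongr with k
          exact h1 k
      _ = γ s := by
          rw [Finset.sum_const, Finset.card_univ, Fintype.card_fin, nsmul_eq_mul, ← mul_assoc,
            ENNReal.inv_mul_cancel (by simpa using hN) (by simp), one_mul]
  have : IsFiniteMeasure ρ := isFiniteMeasure_of_le γ hρle
  have hηR : ∀ k, IsProbabilityMeasure (η.map (R k)) := fun k =>
    Measure.isProbabilityMeasure_map (hRm k).aemeasurable
  have hmass : ρ' Set.univ = ρ Set.univ := by
    simp only [ρ, ρ', Measure.smul_apply, Measure.finsetSum_apply, measure_univ]
  have : IsFiniteMeasure ρ' := ⟨by rw [hmass]; exact measure_lt_top _ _⟩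
  have hγρ : γ - ρ + ρ = γ := Measure.sub_add_cancel_of_le hρle
  -- The competitor replaces `ρ` by its rearrangement `ρ'`. Marginals are kept because each `σ i` is
  -- a bijection; the surplus grows by `c` times the integral of `Φ`.
  have hplan : IsPlan X μ (γ - ρ + ρ') := by
    have hm : ∀ i, (γ - ρ + ρ').map (fun x => x i) = μ i := by
      intro i
      rw [Measure.map_add _ _ (measurable_pi_apply i), hρm,
        ← Measure.map_add _ _ (measurable_pi_apply i), hγρ, hγ.1.marginal i]
    refine ⟨⟨?_⟩, measure_compl_pi_eq_zero hX fun i => by rw [hm, hμX], hm⟩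
    rw [Measure.add_apply, hmass, ← Measure.add_apply, hγρ, measure_univ]
  have hle := hγ.2 _ hplan
  have hiν : ∀ k, Integrable b (ν k) := fun k =>
    integrable_of_measure_compl_pi_eq_zero hXbdd hb
      (cond_absolutelyContinuous hγ.1.concentrated)
  have hiη : ∀ k, Integrable b (η.map (R k)) := fun k => by
    refine integrable_of_measure_compl_pi_eq_zero hXbdd hb
      (measure_compl_pi_eq_zero hX fun i => ?_)
    rw [hmarg]
    refine (cond_absolutelyContinuous (μ := γ) (s := U (σ i k))).map (measurable_pi_apply i) ?_
    rw [hγ.1.marginal i, hμX]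
  have hi1 : Integrable b (γ - ρ) :=
    integrable_of_measure_compl_pi_eq_zero hXbdd hb
      (Measure.absolutelyContinuous_of_le Measure.sub_le hγ.1.concentrated)
  have hi2 : Integrable b ρ :=
    integrable_of_measure_compl_pi_eq_zero hXbdd hb
      (Measure.absolutelyContinuous_of_le hρle hγ.1.concentrated)
  have hi3 : Integrable b ρ' :=
    (integrable_finsetSum_measure.2 fun k _ => hiη k).smul_measure hctop
  have hle2 : ∫ x, b x ∂ρ' ≤ ∫ x, b x ∂ρ := by
    rw [integral_add_measure hi1 hi3] at hle
    conv_rhs at hle => rw [← hγρ]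
    rw [integral_add_measure hi1 hi2] at hle
    linarith
  have hiη' : ∀ k, Integrable (fun z => b (R k z)) η := fun k => (hiη k).comp_measurable (hRm k)
  have hmp : ∀ k, η.map (fun z => z k) = ν k := fun k => (measurePreserving_eval ν k).map_eq
  have hiν' : ∀ k, Integrable (fun z : Fin N → V → EuclideanSpace ℝ (Fin n) => b (z k)) η :=
    fun k => ((measurePreserving_eval ν k).integrable_comp hb.aestronglyMeasurable).2 (hiν k)
  have e1 : ∫ x, b x ∂ρ' = c.toReal * ∑ k, ∫ z, b (R k z) ∂η := by
    simp only [ρ']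
    rw [integral_smul_measure, integral_finsetSum_measure fun k _ => hiη k, smul_eq_mul]
    congr 1
    exact Finset.sum_congr rfl fun k _ =>
      integral_map (hRm k).aemeasurable hb.aestronglyMeasurable
  have e2 : ∫ x, b x ∂ρ = c.toReal * ∑ k, ∫ z, b (z k) ∂η := by
    simp only [ρ]
    rw [integral_smul_measure, integral_finsetSum_measure fun k _ => hiν k, smul_eq_mul]
    congr 1
    refine Finset.sum_congr rfl fun k _ => ?_
    rw [← hmp k]
    exact integral_map (measurable_pi_apply k).aemeasurable hb.aestronglyMeasurable
  have hΦi : Integrable Φ η :=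
    (integrable_finsetSum _ fun k _ => hiη' k).sub (integrable_finsetSum _ fun k _ => hiν' k)
  have e3 : ∫ z, Φ z ∂η = ∑ k, ∫ z, b (R k z) ∂η - ∑ k, ∫ z, b (z k) ∂η := by
    simp only [Φ]
    rw [integral_sub (integrable_finsetSum _ fun k _ => hiη' k)
      (integrable_finsetSum _ fun k _ => hiν' k), integral_finsetSum _ fun k _ => hiη' k,
      integral_finsetSum _ fun k _ => hiν' k]
  have hΦpos : ∀ᵐ z ∂η, 0 < Φ z := by
    have : ∀ᵐ z ∂η, ∀ k, z k ∈ U k := by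
      refine ae_all_iff.2 fun k => ?_
      have : ∀ᵐ y ∂(ν k), y ∈ U k := ae_cond_mem (hUm k)
      exact (measurePreserving_eval ν k).quasiMeasurePreserving.ae this
    filter_upwards [this] with z hz using hUΦ fun k _ => hz k
  have hpos : 0 < ∫ z, Φ z ∂η := by
    refine lt_of_le_of_ne (integral_nonneg_of_ae (hΦpos.mono fun z hz => hz.le)) fun h0 => ?_
    have h1 := (integral_eq_zero_iff_of_nonneg_ae (hΦpos.mono fun z hz => hz.le) hΦi).1 h0.symm
    have h2 : ∀ᵐ _z ∂η, False := by
      filter_upwards [hΦpos, h1] with z hz hz'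
      exact hz.ne' hz'
    simp at h2
    exact (IsProbabilityMeasure.ne_zero η) h2
  rw [e1, e2] at hle2
  have hc : 0 < c.toReal := ENNReal.toReal_pos hc0 hctop
  have := le_of_mul_le_mul_left hle2 hc
  linarith

end Monotone

/-! ### Sums of vectors over vertex sets. -/

section SetSum

variable {V F : Type*} [Fintype V]

/-- The sum of a vector-valued function over a set of vertices. -/
noncomputable def setSum [AddCommMonoid F] (s : Set V) (d : V → F) : F := ∑ i, s.indicator d i

lemma setSum_union [AddCommMonoid F] {s t : Set V} (h : Disjoint s t) (d : V → F) :
    setSum (s ∪ t) d = setSum s d + setSum t d := by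
  simp only [setSum, Set.indicator_union_of_disjoint h, Finset.sum_add_distrib]

lemma setSum_eq_zero [AddCommMonoid F] {s : Set V} {d : V → F} (h : ∀ i ∈ s, d i = 0) :
    setSum s d = 0 :=
  Finset.sum_eq_zero fun i _ => by
    by_cases hi : i ∈ s
    · rw [Set.indicator_of_mem hi, h i hi]
    · rw [Set.indicator_of_notMem hi]

lemma setSum_diff_add [AddCommMonoid F] {s t : Set V} (h : t ⊆ s) (d : V → F) :
    setSum (s \ t) d + setSum t d = setSum s d := by
  rw [← setSum_union Set.disjoint_sdiff_left, Set.sdiff_union_of_subset h]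

lemma setSum_singleton [AddCommMonoid F] (i : V) (d : V → F) : setSum {i} d = d i := by
  rw [setSum, Finset.sum_eq_single i]
  · simp
  · intro j _ hj
    simp [hj]
  · simp

lemma setSum_sub [AddCommGroup F] (s : Set V) (x y : V → F) :
    setSum s (x - y) = setSum s x - setSum s y := by
  simp only [setSum, Set.indicator_sub', Pi.sub_apply, Finset.sum_sub_distrib]

lemma norm_setSum_le [NormedAddCommGroup F] (s : Set V) (x : V → F) :
    ‖setSum s x‖ ≤ Fintype.card V * ‖x‖ := by
  refine (norm_sum_le _ _).trans ?_
  rw [← nsmul_eq_mul, ← Finset.card_univ]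
  exact Finset.sum_le_card_nsmul _ _ _ fun i _ =>
    (norm_indicator_le_norm_self _ _).trans (norm_le_pi_norm x i)

end SetSum

/-! ### Cut inequality and branch property for the graph surplus. -/

section Surplus

variable {V : Type*} [Fintype V] {n : ℕ}

open Classical in
lemma two_mul_surplus (G : Graph V) (x : V → EuclideanSpace ℝ (Fin n)) :
    2 * surplus G x = ∑ i, ∑ j, if G.Adj i j then inner ℝ (x i) (x j) else 0 := by
  rw [← Fintype.sum_prod_type' (fun i j => if G.Adj i j then inner ℝ (x i) (x j) else 0),
    ← Finset.sum_filter, surplus, Finset.mul_sum]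
  rw [← Finset.sum_fiberwise_of_maps_to (t := {e : Sym2 V | e ∈ G.edgeSet})
    (g := fun p : V × V => s(p.1, p.2))]
  · refine Finset.sum_congr rfl fun e he => ?_
    induction e using Sym2.ind with
    | _ a b =>
      have hab : G.Adj a b := by simpa using he
      have : ({p ∈ ({p : V × V | G.Adj p.1 p.2} : Finset (V × V)) | s(p.1, p.2) = s(a, b)}) =
          {(a, b), (b, a)} := by
        ext ⟨i, j⟩
        simp only [Finset.mem_filter, Finset.mem_univ, true_and, Sym2.eq_iff, Finset.mem_insert,
          Finset.mem_singleton, Prod.mk.injEq]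
        constructor
        · exact fun h => h.2
        · rintro (⟨rfl, rfl⟩ | ⟨rfl, rfl⟩)
          exacts [⟨hab, Or.inl ⟨rfl, rfl⟩⟩, ⟨hab.symm, Or.inr ⟨rfl, rfl⟩⟩]
      rw [this, Finset.sum_pair fun h => hab.ne (Prod.mk.inj h).1]
      simp only [edgeProd, Sym2.lift_mk]
      rw [real_inner_comm (x a) (x b), two_mul]
  · rintro ⟨i, j⟩ h
    simpa using h

lemma continuous_surplus (G : Graph V) :
    Continuous (surplus G : (V → EuclideanSpace ℝ (Fin n)) → ℝ) := by
  classical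
  have : (surplus G : (V → EuclideanSpace ℝ (Fin n)) → ℝ) =
      fun x => 2⁻¹ * ∑ i, ∑ j, if G.Adj i j then inner ℝ (x i) (x j) else 0 := by
    ext x
    rw [← two_mul_surplus, inv_mul_cancel_left₀ two_ne_zero]
  rw [this]
  refine continuous_const.mul (continuous_finsetSum _ fun i _ => continuous_finsetSum _ fun j _ => ?_)
  split_ifs
  · fun_prop
  · exact continuous_const

open Classical in
/-- The part of the surplus of `d` carried by the edges between `P` and its complement. -/
noncomputable def cutSum (G : Graph V) (P : Set V) (d : V → EuclideanSpace ℝ (Fin n)) : ℝ :=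
  ∑ i, ∑ j, if i ∈ P ∧ j ∉ P ∧ G.Adj i j then inner ℝ (d i) (d j) else 0

open Classical in
-- Edges inside `P` or inside its complement contribute equally to both sides; on a crossing edge
-- the discrepancy is the product of the differences.
lemma surplus_add_surplus (G : Graph V) (P : Set V) (x y : V → EuclideanSpace ℝ (Fin n)) :
    surplus G x + surplus G y =
      surplus G (P.piecewise x y) + surplus G (P.piecewise y x) + cutSum G P (x - y) := by
  have h : 2 * surplus G x + 2 * surplus G y - 2 * surplus G (P.piecewise x y) -
      2 * surplus G (P.piecewise y x) = cutSum G P (x - y) + cutSum G P (x - y) := by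
    conv_rhs => rw [cutSum]; arg 2; rw [Finset.sum_comm]
    simp only [two_mul_surplus, ← Finset.sum_add_distrib, ← Finset.sum_sub_distrib]
    refine Finset.sum_congr rfl fun i _ => Finset.sum_congr rfl fun j _ => ?_
    by_cases hi : i ∈ P <;> by_cases hj : j ∈ P <;> by_cases hij : G.Adj i j <;>
      simp only [hi, hj, hij, G.adj_comm j i, Set.piecewise_eq_of_mem,
        Set.piecewise_eq_of_notMem, not_true_eq_false, not_false_eq_true, if_true, if_false,
        and_true, and_false, Pi.sub_apply, inner_sub_left, inner_sub_right,
        real_inner_comm (x j) (x i), real_inner_comm (x j) (y i), real_inner_comm (y j) (x i),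
        real_inner_comm (y j) (y i)] <;> ring
  linarith

lemma cutSum_eq_zero {G : Graph V} {P : Set V} {d : V → EuclideanSpace ℝ (Fin n)}
    (h : ∀ i ∉ P, ∀ j ∈ P, G.Adj i j → d i = 0) : cutSum G P d = 0 := by
  refine Finset.sum_eq_zero fun i _ => Finset.sum_eq_zero fun j _ => ?_
  split_ifs with hc
  · rw [h j hc.2.1 i hc.1 hc.2.2.symm, inner_zero_right]
  · rfl

/-- If the edges between `P` and its complement form a complete bipartite graph with sides `s`
and `t`, the cut sum is a scalar product. -/
lemma cutSum_eq_inner {G : Graph V} {P s t : Set V} (hs : s ⊆ P) (ht : Disjoint t P)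
    (h : ∀ i ∈ P, ∀ j ∉ P, G.Adj i j ↔ i ∈ s ∧ j ∈ t) (d : V → EuclideanSpace ℝ (Fin n)) :
    cutSum G P d = inner ℝ (setSum s d) (setSum t d) := by
  classical
  rw [cutSum, setSum, sum_inner]
  simp only [setSum, inner_sum]
  refine Finset.sum_congr rfl fun i _ => Finset.sum_congr rfl fun j _ => ?_
  have hst : (i ∈ P ∧ j ∉ P ∧ G.Adj i j) ↔ (i ∈ s ∧ j ∈ t) := by
    constructor
    · rintro ⟨hi, hj, hij⟩
      exact (h i hi j hj).1 hij
    · rintro ⟨hi, hj⟩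
      have hj' : j ∉ P := fun hP => ht.le_bot ⟨hj, hP⟩
      exact ⟨hs hi, hj', (h i (hs hi) j hj').2 ⟨hi, hj⟩⟩
  simp only [hst, Set.indicator_apply]
  by_cases hi : i ∈ s <;> by_cases hj : j ∈ t <;> simp [hi, hj]

open Classical in
lemma surplus_update (G : Graph V) (x : V → EuclideanSpace ℝ (Fin n)) (p : V)
    (z : EuclideanSpace ℝ (Fin n)) :
    surplus G (Function.update x p z) =
      surplus G x + inner ℝ (z - x p) (setSum (G.neighborSet p) x) := by
  let T : V → V → ℝ := fun i j => if i = p ∧ G.Adj i j then inner ℝ (z - x p) (x j) else 0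
  have hT : ∑ i, ∑ j, T i j = inner ℝ (z - x p) (setSum (G.neighborSet p) x) := by
    rw [Finset.sum_eq_single p]
    · simp only [T, setSum, inner_sum, Set.indicator_apply, SimpleGraph.Subgraph.mem_neighborSet,
        true_and]
      refine Finset.sum_congr rfl fun j _ => ?_
      split_ifs <;> simp
    · intro i _ hi
      simp [T, hi]
    · simp
  have h : 2 * surplus G (Function.update x p z) - 2 * surplus G x =
      ∑ i, ∑ j, T i j + ∑ i, ∑ j, T i j := by
    conv_rhs => arg 2; rw [Finset.sum_comm]
    simp only [two_mul_surplus, ← Finset.sum_add_distrib, ← Finset.sum_sub_distrib]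
    refine Finset.sum_congr rfl fun i _ => Finset.sum_congr rfl fun j _ => ?_
    by_cases hij : G.Adj i j
    · have hne := hij.ne
      by_cases hi : i = p
      · subst hi
        simp [T, hij, hne.symm, inner_sub_left]
      · by_cases hj : j = p
        · subst hj
          simp [T, hij, hij.symm, hne, inner_sub_left, real_inner_comm (x i)]
        · simp [T, hi, hj]
    · simp [T, hij, G.adj_comm j i]
  rw [hT] at h
  linarith

open Classical in
lemma RearrangementMonotone.cutSum_nonneg {G : Graph V}
    {Γ : Set (V → EuclideanSpace ℝ (Fin n))} (hΓ : RearrangementMonotone (surplus G) Γ)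
    {x y : V → EuclideanSpace ℝ (Fin n)} (hx : x ∈ Γ) (hy : y ∈ Γ) (P : Set V) :
    0 ≤ cutSum G P (x - y) := by
  have h := hΓ.sum_le (fun b : Bool => if b then x else y)
    (fun i => if i ∈ P then 1 else Equiv.swap true false) (by simp [hx, hy])
  have e1 : (fun i => (if ((if i ∈ P then 1 else Equiv.swap true false : Equiv.Perm Bool) true)
      then x else y) i) = P.piecewise x y := by
    ext1 i
    by_cases hi : i ∈ P <;> simp [hi]
  have e2 : (fun i => (if ((if i ∈ P then 1 else Equiv.swap true false : Equiv.Perm Bool) false)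
      then x else y) i) = P.piecewise y x := by
    ext1 i
    by_cases hi : i ∈ P <;> simp [hi]
  rw [Fintype.sum_bool, Fintype.sum_bool, e1, e2] at h
  have := surplus_add_surplus G P x y
  simp only [if_true, Bool.false_eq_true, if_false] at h
  linarith

/-- For `p ∉ B`, the sum of the coordinates of the neighbours of `p` in `B` is determined, off a
Lebesgue null set of values of the coordinate at `p`, by the coordinates on the boundary
of `B`. -/
theorem RearrangementMonotone.exists_null_set {G : Graph V}
    {Γ : Set (V → EuclideanSpace ℝ (Fin n))} (hΓ : RearrangementMonotone (surplus G) Γ)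
    (hbdd : Bornology.IsBounded Γ) {B : Set V} {p : V} (hp : p ∉ B) :
    ∃ N : Set (EuclideanSpace ℝ (Fin n)), volume N = 0 ∧ ∀ x ∈ Γ, ∀ y ∈ Γ, x p ∉ N →
      x p = y p → (∀ i ∉ B, ∀ j ∈ B, G.Adj i j → x i = y i) →
        setSum (G.neighborSet p ∩ B) (x - y) = 0 := by
  classical
  -- The mixtures of `x` on `B` and `y` elsewhere. They need not lie in `Γ`, but their partners
  -- `B.piecewise y x` restore the total surplus of `x` and `y`.
  let Z : Set (V → EuclideanSpace ℝ (Fin n)) := {z | ∃ x ∈ Γ, ∃ y ∈ Γ,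
    (∀ i ∉ B, ∀ j ∈ B, G.Adj i j → x i = y i) ∧ z = B.piecewise x y}
  let Q : (V → EuclideanSpace ℝ (Fin n)) → EuclideanSpace ℝ (Fin n) × EuclideanSpace ℝ (Fin n) :=
    fun z => (z p, setSum (G.neighborSet p) z)
  have hcm : CyclicallyMonotone (Q '' Z) := by
    intro N f hf τ
    choose z hz hzf using hf
    choose x hx y hy hxy hzxy using hz
    obtain rfl : f = fun k => Q (z k) := funext fun k => (hzf k).symm
    -- With the identity on `B` and the swap `σn` off `B ∪ {p}`, this turns the `x k` into the
    -- mixtures `z k` with `p`-coordinate replaced by that of `z (τ k)`, and the `y k` into the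
    -- unchanged partners. Hence only the coordinates at `p` are permuted among the mixtures.
    let σp : Equiv.Perm (Fin N × Bool) :=
      { toFun := fun q => if q.2 then (τ q.1, false) else (q.1, true)
        invFun := fun q => if q.2 then (q.1, false) else (τ.symm q.1, true)
        left_inv := by rintro ⟨k, _ | _⟩ <;> simp
        right_inv := by rintro ⟨k, _ | _⟩ <;> simp }
    let σn : Equiv.Perm (Fin N × Bool) := (Equiv.refl _).prodCongr (Equiv.swap true false)
    have h := hΓ.sum_le (fun q : Fin N × Bool => if q.2 then x q.1 else y q.1)
      (fun i => if i ∈ B then 1 else if i = p then σp else σn) (by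
        rintro ⟨k, _ | _⟩
        exacts [by simpa using hy k, by simpa using hx k])
    have et : ∀ k, (fun i => (if ((if i ∈ B then 1 else if i = p then σp else σn :
        Equiv.Perm (Fin N × Bool)) (k, true)).2 then x ((if i ∈ B then 1 else
        if i = p then σp else σn : Equiv.Perm (Fin N × Bool)) (k, true)).1 else
        y ((if i ∈ B then 1 else if i = p then σp else σn :
        Equiv.Perm (Fin N × Bool)) (k, true)).1) i) = Function.update (z k) p (z (τ k) p) := by
      intro k
      ext1 i
      rw [hzxy, hzxy]
      by_cases hi : i = p
      · subst hi
        simp [hp, σp]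
      · by_cases hB : i ∈ B <;> simp [hi, hB, σn]
    have ef : ∀ k, (fun i => (if ((if i ∈ B then 1 else if i = p then σp else σn :
        Equiv.Perm (Fin N × Bool)) (k, false)).2 then x ((if i ∈ B then 1 else
        if i = p then σp else σn : Equiv.Perm (Fin N × Bool)) (k, false)).1 else
        y ((if i ∈ B then 1 else if i = p then σp else σn :
        Equiv.Perm (Fin N × Bool)) (k, false)).1) i) = B.piecewise (y k) (x k) := by
      intro k
      ext1 i
      by_cases hi : i = p
      · subst hi
        simp [hp, σp]
      · by_cases hB : i ∈ B <;> simp [hi, hB, σn]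
    rw [Fintype.sum_prod_type, Fintype.sum_prod_type] at h
    simp only [Fintype.sum_bool, et, ef, if_true, Bool.false_eq_true, if_false] at h
    have hsw : ∀ k, surplus G (x k) + surplus G (y k) =
        surplus G (z k) + surplus G (B.piecewise (y k) (x k)) := by
      intro k
      rw [surplus_add_surplus G B, cutSum_eq_zero, add_zero, ← hzxy]
      intro i hi j hj hij
      simp [hxy k i hi j hj hij]
    simp only [hsw, surplus_update, Finset.sum_add_distrib, inner_sub_left,
      Finset.sum_sub_distrib] at h
    simp only [Q]
    linarith
  obtain ⟨R, hR⟩ := hbdd.exists_norm_le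
  have hQR : ∀ q ∈ Q '' Z, ‖q.2‖ ≤ Fintype.card V * R := by
    rintro _ ⟨_, ⟨x, hx, y, hy, -, rfl⟩, rfl⟩
    refine (norm_setSum_le _ _).trans ?_
    gcongr
    refine (pi_norm_le_iff_of_nonneg ((norm_nonneg x).trans (hR x hx))).2 fun i => ?_
    by_cases hi : i ∈ B
    · simpa [hi] using (norm_le_pi_norm x i).trans (hR x hx)
    · simpa [hi] using (norm_le_pi_norm y i).trans (hR y hy)
  obtain ⟨N, hN, hdet⟩ := hcm.exists_null_set hQR
  refine ⟨N, hN, fun x hx y hy hxN hxy hbd => ?_⟩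
  -- The mixture of `x` and `y` is compared with `y`, the mixture of `y` with itself; the two differ
  -- only on `B`.
  have h := hdet _ (Set.mem_image_of_mem Q ⟨x, hx, y, hy, hbd, rfl⟩) _
    (Set.mem_image_of_mem Q ⟨y, hy, y, hy, fun _ _ _ _ _ => rfl, rfl⟩)
    (by simp [Q, hp]) (by simpa [Q, hp, ← hxy] using hxN)
  simp only [Q, Set.piecewise_same] at h
  rw [← sub_eq_zero, ← setSum_sub] at h
  rw [← h]
  refine Finset.sum_congr rfl fun i _ => ?_
  by_cases hi : i ∈ B <;> simp [Set.indicator_apply, hi]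

end Surplus

/-! ### Maximal cliques and inner hubs. -/

section InnerHub

variable {V : Type*} {S : Graph V} {A L : Set V}

lemma IsMaxCliqueOf.subset_verts (hL : IsMaxCliqueOf S L) : L ⊆ S.verts := hL.prop.1

lemma IsMaxCliqueOf.adj (hL : IsMaxCliqueOf S L) {i j : V} (hi : i ∈ L) (hj : j ∈ L)
    (h : i ≠ j) : S.Adj i j := hL.prop.2 hi hj h

lemma IsCliqueOf.exists_isMaxCliqueOf [Finite V] (h : IsCliqueOf S L) :
    ∃ K, L ⊆ K ∧ IsMaxCliqueOf S K :=
  Set.Finite.exists_le_maximal (Set.toFinite {K | IsCliqueOf S K}) h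

lemma exists_isMaxCliqueOf_of_mem [Finite V] {i : V} (hi : i ∈ S.verts) :
    ∃ K, IsMaxCliqueOf S K ∧ i ∈ K := by
  have h : IsCliqueOf S {i} := ⟨by simpa using hi, by simp⟩
  obtain ⟨K, hK, hmax⟩ := h.exists_isMaxCliqueOf
  exact ⟨K, hmax, hK rfl⟩

lemma exists_isMaxCliqueOf_of_adj [Finite V] {i j : V} (hij : S.Adj i j) :
    ∃ K, IsMaxCliqueOf S K ∧ i ∈ K ∧ j ∈ K := by
  have h : IsCliqueOf S {i, j} := by
    refine ⟨Set.insert_subset hij.fst_mem (by simpa using hij.snd_mem), ?_⟩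
    simpa [SimpleGraph.isClique_pair] using fun _ => hij
  obtain ⟨K, hK, hmax⟩ := h.exists_isMaxCliqueOf
  exact ⟨K, hmax, hK (by simp), hK (by simp)⟩

lemma IsInnerHub.eq_of_mem (hA : IsInnerHub S A) {K : Set V} (hL : IsMaxCliqueOf S L)
    (hK : IsMaxCliqueOf S K) {i : V} (hiL : i ∈ L) (hiK : i ∈ K) (hi : i ∉ A) : L = K := by
  by_contra hne
  exact hi (hA.1 L K hL hK hne ▸ ⟨hiL, hiK⟩)

/-- With two maximal cliques the hub is an intersection; with only one the graph is complete and the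
convention for complete graphs applies. -/
lemma IsInnerHub.subset [Finite V] (hA : IsInnerHub S A) (hL : IsMaxCliqueOf S L) : A ⊆ L := by
  by_cases h : ∃ K, IsMaxCliqueOf S K ∧ K ≠ L
  · obtain ⟨K, hK, hne⟩ := h
    rw [← hA.1 K L hK hL hne]
    exact Set.inter_subset_right
  · push Not at h
    have hV : S.verts = L := by
      refine Set.Subset.antisymm (fun i hi => ?_) hL.subset_verts
      obtain ⟨K, hK, hiK⟩ := exists_isMaxCliqueOf_of_mem hi
      exact h K hK ▸ hiK
    rw [hA.2 (hV ▸ hL.prop), hV]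

lemma IsInnerHub.adj [Finite V] (hA : IsInnerHub S A) {i j : V} (hi : i ∈ A) (hj : j ∈ S.verts)
    (hij : i ≠ j) : S.Adj i j := by
  obtain ⟨K, hK, hjK⟩ := exists_isMaxCliqueOf_of_mem hj
  exact hK.adj (hA.subset hK hi) hjK hij

lemma IsInnerHub.mem_of_adj [Finite V] (hA : IsInnerHub S A) (hL : IsMaxCliqueOf S L) {i j : V}
    (hi : i ∈ L) (hiA : i ∉ A) (hij : S.Adj i j) : j ∈ L := by
  obtain ⟨K, hK, hiK, hjK⟩ := exists_isMaxCliqueOf_of_adj hij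
  rwa [hA.eq_of_mem hL hK hi hiK hiA]

end InnerHub

/-! ### Neighbourhoods in the glued graph. -/

/-- `G` is the union of a graph `S o` with inner hub `A o` and of graphs `S α`, `α ∈ E`, with
inner hubs `A α` disjoint from `A o`, glued to `S o` on the cliques `K α`. -/
structure HubGluing {V ι : Type*} (G : Graph V) (S : ι → Graph V) (A K : ι → Set V) (o : ι)
    (E : Set ι) : Prop where
  adj_iff : ∀ i j, G.Adj i j ↔ (S o).Adj i j ∨ ∃ α ∈ E, (S α).Adj i j
  mem_verts : ∀ i, i ∈ (S o).verts ∨ ∃ α ∈ E, i ∈ (S α).verts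
  hub_center : IsInnerHub (S o) (A o)
  hub : ∀ α ∈ E, IsInnerHub (S α) (A α)
  notMem_hub : ∀ α ∈ E, ∀ i ∈ A α, i ∉ A o
  max : ∀ α ∈ E, IsMaxCliqueOf (S α) (K α)
  max_center : ∀ α ∈ E, IsMaxCliqueOf (S o) (K α)
  inter : ∀ α ∈ E, ∀ i ∈ (S α).verts, i ∈ (S o).verts → i ∈ K α
  inter_pair : ∀ α ∈ E, ∀ β ∈ E, ∀ i ∈ (S α).verts, i ∈ (S β).verts → α = β ∨ i ∈ A o

namespace HubGluing

variable {V ι : Type*} {G : Graph V} {S : ι → Graph V} {A K : ι → Set V} {o : ι}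
  {E : Set ι} {α : ι} {L : Set V} {i j : V}

lemma subset_verts (h : HubGluing G S A K o E)
    (hα : α ∈ E) : K α ⊆ (S α).verts := (h.max α hα).subset_verts

lemma subset_verts_center (h : HubGluing G S A K o E)
    (hα : α ∈ E) : K α ⊆ (S o).verts := (h.max_center α hα).subset_verts

lemma eq_clique (h : HubGluing G S A K o E)
    (hα : α ∈ E) (hL : IsMaxCliqueOf (S o) L) (hi : i ∈ L) (hiA : i ∉ A o)
    (hiα : i ∈ (S α).verts) : K α = L :=
  h.hub_center.eq_of_mem (h.max_center α hα) hL (h.inter α hα i hiα (hL.subset_verts hi)) hi hiA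

lemma notMem_verts_center (h : HubGluing G S A K o E)
    (hα : α ∈ E) (hL : IsMaxCliqueOf (S α) L) (hne : L ≠ K α) (hi : i ∈ L)
    (hiA : i ∉ A α) : i ∉ (S o).verts := fun hio =>
  hne ((h.hub α hα).eq_of_mem hL (h.max α hα) hi (h.inter α hα i (hL.subset_verts hi) hio) hiA)

variable [Finite V]

lemma hub_center_subset (h : HubGluing G S A K o E)
    (hα : α ∈ E) : A o ⊆ K α := h.hub_center.subset (h.max_center α hα)

lemma hub_subset (h : HubGluing G S A K o E)
    (hα : α ∈ E) : A α ⊆ K α := (h.hub α hα).subset (h.max α hα)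

lemma hub_center_subset_verts (h : HubGluing G S A K o E) : A o ⊆ (S o).verts := by
  intro i hi
  rcases h.mem_verts i with h' | ⟨α, hα, -⟩
  · exact h'
  · exact h.subset_verts_center hα (h.hub_center_subset hα hi)

/-- Gluing adds no neighbours: in `S α` such a vertex lies in `K α` off the hub `A α`, so its
neighbours there stay in `K α`, inside `S o`. -/
lemma adj_hub_center (h : HubGluing G S A K o E)
    (hi : i ∈ A o) : G.Adj i j ↔ j ∈ (S o).verts ∧ j ≠ i := by
  rw [h.adj_iff]
  constructor
  · rintro (hij | ⟨α, hα, hij⟩)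
    · exact ⟨hij.snd_mem, hij.ne.symm⟩
    · refine ⟨h.subset_verts_center hα ?_, hij.ne.symm⟩
      exact (h.hub α hα).mem_of_adj (h.max α hα) (h.hub_center_subset hα hi)
        (fun hi' => h.notMem_hub α hα i hi' hi) hij
  · rintro ⟨hj, hne⟩
    exact Or.inl (h.hub_center.adj hi hj hne.symm)

/-- Off `A o`, such a vertex belongs to no other `S β`, and its neighbours in `S o` stay in `K α`.
-/
lemma adj_hub (h : HubGluing G S A K o E)
    (hα : α ∈ E) (hi : i ∈ A α) : G.Adj i j ↔ j ∈ (S α).verts ∧ j ≠ i := by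
  have hio := h.notMem_hub α hα i hi
  have hiK := h.hub_subset hα hi
  rw [h.adj_iff]
  constructor
  · rintro (hij | ⟨β, hβ, hij⟩)
    · exact ⟨h.subset_verts hα (h.hub_center.mem_of_adj (h.max_center α hα) hiK hio hij), hij.ne.symm⟩
    · obtain rfl := (h.inter_pair α hα β hβ i (h.subset_verts hα hiK) hij.fst_mem).resolve_right hio
      exact ⟨hij.snd_mem, hij.ne.symm⟩
  · rintro ⟨hj, hne⟩
    exact Or.inr ⟨α, hα, (h.hub α hα).adj hi hj hne.symm⟩

lemma adj_clique_center (h : HubGluing G S A K o E)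
    (hL : IsMaxCliqueOf (S o) L) (hi : i ∈ L) (hio : i ∉ A o)
    (hiE : ∀ α ∈ E, i ∉ A α) : G.Adj i j ↔ j ∈ L ∧ j ≠ i := by
  rw [h.adj_iff]
  constructor
  · rintro (hij | ⟨α, hα, hij⟩)
    · exact ⟨h.hub_center.mem_of_adj hL hi hio hij, hij.ne.symm⟩
    · obtain rfl := h.eq_clique hα hL hi hio hij.fst_mem
      exact ⟨(h.hub α hα).mem_of_adj (h.max α hα) hi (hiE α hα) hij, hij.ne.symm⟩
  · rintro ⟨hj, hne⟩
    exact Or.inl (hL.adj hi hj hne.symm)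

lemma adj_clique (h : HubGluing G S A K o E)
    (hα : α ∈ E) (hL : IsMaxCliqueOf (S α) L) (hne : L ≠ K α) (hi : i ∈ L)
    (hiA : i ∉ A α) : G.Adj i j ↔ j ∈ L ∧ j ≠ i := by
  have hio := h.notMem_verts_center hα hL hne hi hiA
  rw [h.adj_iff]
  constructor
  · rintro (hij | ⟨β, hβ, hij⟩)
    · exact absurd hij.fst_mem hio
    · obtain rfl := (h.inter_pair α hα β hβ i (hL.subset_verts hi) hij.fst_mem).resolve_right
        fun hc => hio (h.hub_center_subset_verts hc)
      exact ⟨(h.hub α hα).mem_of_adj hL hi hiA hij, hij.ne.symm⟩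
  · rintro ⟨hj, hn⟩
    exact Or.inr ⟨α, hα, hL.adj hi hj hn.symm⟩

/-- The vertices that the hub `A o` separates from the other cliques of `S o`. -/
lemma boundary_center (h : HubGluing G S A K o E) (hL : IsMaxCliqueOf (S o) L)
    (hi : ¬((i ∈ L ∧ i ∉ A o) ∨ ∃ α ∈ E, K α = L ∧ i ∈ (S α).verts ∧ i ∉ (S o).verts))
    (hj : (j ∈ L ∧ j ∉ A o) ∨ ∃ α ∈ E, K α = L ∧ j ∈ (S α).verts ∧ j ∉ (S o).verts)
    (hij : G.Adj i j) : i ∈ A o := by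
  by_contra hio
  push Not at hi
  have hiL : i ∉ L := fun h' => hio (hi.1 h')
  rcases (h.adj_iff i j).1 hij with hij | ⟨β, hβ, hij⟩
  · rcases hj with ⟨hjL, hjo⟩ | ⟨α, -, -, -, hjo⟩
    · exact hiL (h.hub_center.mem_of_adj hL hjL hjo hij.symm)
    · exact hjo hij.snd_mem
  · have hβL : K β = L := by
      rcases hj with ⟨hjL, hjo⟩ | ⟨α, hα, hαL, hjα, hjo⟩
      · exact h.eq_clique hβ hL hjL hjo hij.snd_mem
      · obtain rfl := (h.inter_pair α hα β hβ j hjα hij.snd_mem).resolve_right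
          fun hc => hjo (h.hub_center_subset_verts hc)
        exact hαL
    exact hiL (hβL ▸ h.inter β hβ i hij.fst_mem (hi.2 β hβ hβL hij.fst_mem))

/-- The hub `A α` separates the vertices of `S α` off `K α` from the rest of the graph. -/
lemma boundary_hub (h : HubGluing G S A K o E) (hα : α ∈ E) (hi : i ∈ (S α).verts) (hiK : i ∉ K α)
    (hj : j ∉ (S α).verts ∨ j ∈ K α) (hij : G.Adj i j) : j ∈ A α := by
  by_contra hjA
  obtain ⟨L, hL, hiL⟩ := exists_isMaxCliqueOf_of_mem hi
  have hne : L ≠ K α := by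
    rintro rfl
    exact hiK hiL
  have hjL := ((h.adj_clique hα hL hne hiL fun hiA => hiK (h.hub_subset hα hiA)).1 hij).1
  have hjo := h.notMem_verts_center hα hL hne hjL hjA
  exact hj.elim (fun hj => hj (hL.subset_verts hjL)) fun hj => hjo (h.subset_verts_center hα hj)

end HubGluing

/-! ### Propagation of zeros of a rigid difference. -/

/-- The properties of the difference of two points of a monotone set that have the same
coordinates at the vertices of `P` whose marginals are absolutely continuous, up to null sets. -/
structure IsRigid {V : Type*} [Fintype V] {n : ℕ} (G : Graph V) (P : Set V)
    (d : V → EuclideanSpace ℝ (Fin n)) : Prop where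
  cut : ∀ Q : Set V, 0 ≤ cutSum G Q d
  branch : ∀ p ∈ P, ∀ B : Set V, p ∉ B → d p = 0 →
    (∀ i ∉ B, ∀ j ∈ B, G.Adj i j → d i = 0) → setSum (G.neighborSet p ∩ B) d = 0

namespace IsRigid

variable {V : Type*} [Fintype V] {n : ℕ} {G : Graph V} {P : Set V}
  {d : V → EuclideanSpace ℝ (Fin n)}

lemma setSum_neighborSet_add {W : Set V} {i : V} (hi : i ∈ W)
    (hW : ∀ j, G.Adj i j ↔ j ∈ W ∧ j ≠ i) (d : V → EuclideanSpace ℝ (Fin n)) :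
    setSum (G.neighborSet i) d + d i = setSum W d := by
  have : G.neighborSet i = W \ {i} := by
    ext j
    simp [hW]
  rw [this, ← setSum_singleton i d, setSum_diff_add (by simpa using hi)]

/-- This is the cut inequality for the single vertex `i`. -/
lemma norm_sq_le (hd : IsRigid G P d) {W : Set V} {i : V} (hi : i ∈ W)
    (hW : ∀ j, G.Adj i j ↔ j ∈ W ∧ j ≠ i) : ‖d i‖ ^ 2 ≤ inner ℝ (d i) (setSum W d) := by
  have h := hd.cut {i}
  rw [cutSum_eq_inner (s := {i}) (t := G.neighborSet i) subset_rfl, setSum_singleton] at h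
  · rw [← setSum_neighborSet_add hi hW, inner_add_right, real_inner_self_eq_norm_sq]
    linarith
  · simpa using fun h : G.Adj i i => h.ne rfl
  · rintro _ rfl j hj
    simp

lemma eq_zero_of_inner_nonpos (hd : IsRigid G P d) {A W : Set V} (hAW : A ⊆ W)
    (hW : ∀ i ∈ A, ∀ j, G.Adj i j ↔ j ∈ W ∧ j ≠ i)
    (hle : inner ℝ (setSum A d) (setSum W d) ≤ 0) : ∀ i ∈ A, d i = 0 := by
  classical
  have h1 : ∑ i, (if i ∈ A then ‖d i‖ ^ 2 else 0) ≤ inner ℝ (setSum A d) (setSum W d) := by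
    rw [setSum, sum_inner]
    refine Finset.sum_le_sum fun i _ => ?_
    by_cases hi : i ∈ A
    · simpa [hi] using hd.norm_sq_le (hAW hi) (hW i hi)
    · simp [hi]
  have hnn : ∀ i ∈ Finset.univ, 0 ≤ (if i ∈ A then ‖d i‖ ^ 2 else 0) := fun i _ => by
    split_ifs <;> positivity
  have h2 := (Finset.sum_eq_zero_iff_of_nonneg hnn).1
    (le_antisymm (h1.trans hle) (Finset.sum_nonneg hnn))
  intro i hi
  simpa [hi] using h2 i (Finset.mem_univ i)

lemma eq_zero_of_setSum_eq_zero (hd : IsRigid G P d) {A W : Set V} (hAW : A ⊆ W)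
    (hW : ∀ i ∈ A, ∀ j, G.Adj i j ↔ j ∈ W ∧ j ≠ i)
    (h0 : setSum A d = 0 ∨ setSum W d = 0) : ∀ i ∈ A, d i = 0 :=
  hd.eq_zero_of_inner_nonpos hAW hW (by rcases h0 with h0 | h0 <;> simp [h0])

/-- The branch property with `B` the complement of `i`, whose only possible boundary vertex is `i`.
-/
lemma setSum_eq_zero_of_eq_zero (hd : IsRigid G P d) {W : Set V} {i : V} (hiP : i ∈ P) (hi : i ∈ W)
    (hW : ∀ j, G.Adj i j ↔ j ∈ W ∧ j ≠ i) (h0 : d i = 0) : setSum W d = 0 := by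
  have h := hd.branch i hiP {i}ᶜ (by simp) h0 (by
    intro j hj _ _ _
    rwa [Set.notMem_compl_iff.1 hj])
  have hs : G.neighborSet i ∩ {i}ᶜ = G.neighborSet i :=
    Set.inter_eq_left.2 fun j (hj : G.Adj i j) (e : j = i) => hj.ne e.symm
  rw [← setSum_neighborSet_add hi hW, h0, add_zero, ← h, hs]

variable {ι : Type*} {S : ι → Graph V} {A K : ι → Set V} {o : ι} {E : Set ι}
  {α : ι} {L : Set V}

lemma eq_zero_of_notMem_hub (hd : IsRigid G P d) (h : HubGluing G S A K o E)
    (hL : IsMaxCliqueOf (S o) L) (h0 : setSum L d = 0) {i : V}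
    (hi : i ∈ L) (hio : i ∉ A o) (hiE : ∀ α ∈ E, i ∉ A α) : d i = 0 :=
  hd.eq_zero_of_setSum_eq_zero (A := {i}) (by simpa using hi)
    (by rintro _ rfl j; exact h.adj_clique_center hL hi hio hiE) (Or.inr h0) i rfl

/-- The branch `B` is `L` without `A o`, together with whatever is glued on `L`. The hub separates
it from the rest, and a hub vertex sees exactly `L \ A o` in it, so `d` sums to zero over `L`. -/
lemma eq_zero_of_center (hd : IsRigid G P d) (h : HubGluing G S A K o E)
    (hP : ∃ p ∈ A o, p ∈ P) (h0 : ∀ i ∈ A o, d i = 0)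
    (hL : IsMaxCliqueOf (S o) L) : ∀ i ∈ L, d i = 0 := by
  obtain ⟨p, hpA, hpP⟩ := hP
  have hAL : A o ⊆ L := h.hub_center.subset hL
  have hD : setSum L d = 0 := by
    have hb := hd.branch p hpP
      {i | (i ∈ L ∧ i ∉ A o) ∨ ∃ α ∈ E, K α = L ∧ i ∈ (S α).verts ∧ i ∉ (S o).verts} ?_ (h0 p hpA)
      fun i hi j hj hij => h0 i (h.boundary_center hL hi hj hij)
    · rw [← setSum_diff_add hAL, setSum_eq_zero h0, add_zero, ← hb]
      congr 1
      ext j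
      simp only [Set.mem_sdiff, Set.mem_inter_iff, SimpleGraph.Subgraph.mem_neighborSet,
        h.adj_hub_center hpA, Set.mem_ofPred_eq]
      constructor
      · rintro ⟨hjL, hjA⟩
        exact ⟨⟨hL.subset_verts hjL, fun e => hjA (e ▸ hpA)⟩, Or.inl ⟨hjL, hjA⟩⟩
      · rintro ⟨⟨hj, -⟩, hj' | ⟨_, -, -, -, hjo⟩⟩
        exacts [hj', absurd hj hjo]
    · rintro (hc | ⟨_, -, -, -, hc⟩)
      exacts [hc.2 hpA, hc (h.hub_center_subset_verts hpA)]
  intro i hi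
  by_cases hio : i ∈ A o
  · exact h0 i hio
  by_cases hiE : ∃ α ∈ E, i ∈ A α
  · obtain ⟨α, hα, hiα⟩ := hiE
    have hV := h.hub_subset hα |>.trans (h.subset_verts hα)
    obtain rfl := h.eq_clique hα hL hi hio (hV hiα)
    refine hd.eq_zero_of_setSum_eq_zero hV (fun i hi j => h.adj_hub hα hi) (Or.inl ?_) i hiα
    have hz : setSum (K α \ A α) d = 0 := by
      refine setSum_eq_zero fun j hj => ?_
      by_cases hjo : j ∈ A o
      · exact h0 j hjo
      · refine hd.eq_zero_of_notMem_hub h hL hD hj.1 hjo fun β hβ hjβ => hj.2 ?_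
        obtain rfl := (h.inter_pair α hα β hβ j (h.subset_verts hα hj.1)
          (h.subset_verts hβ (h.hub_subset hβ hjβ))).resolve_right hjo
        exact hjβ
    rw [← hD, ← setSum_diff_add (h.hub_subset hα), hz, zero_add]
  · push Not at hiE
    exact hd.eq_zero_of_notMem_hub h hL hD hi hio hiE

lemma eq_zero_of_hub (hd : IsRigid G P d) (h : HubGluing G S A K o E)
    (hα : α ∈ E) (hP : ∃ p ∈ A α, p ∈ P) (h0 : ∀ i ∈ A α, d i = 0) :
    ∀ i ∈ (S α).verts, d i = 0 := by
  obtain ⟨p, hpA, hpP⟩ := hP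
  have hAK := h.hub_subset hα
  have hmax := h.max α hα
  intro i hi
  obtain ⟨L, hL, hiL⟩ := exists_isMaxCliqueOf_of_mem hi
  have hAL : A α ⊆ L := (h.hub α hα).subset hL
  by_cases hne : L = K α
  · subst hne
    -- Everything except `A α` and the part of `S α` off `K α`: only `A α` borders this branch, and
    -- `p` sees exactly `K α \ A α` in it.
    have hb := hd.branch p hpP {j | (j ∉ (S α).verts ∨ j ∈ K α) ∧ j ∉ A α}
      (fun hc => hc.2 hpA) (h0 p hpA) (by
        intro i hi j hj hij
        by_contra hdi
        have hiA : i ∉ A α := fun hc => hdi (h0 i hc)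
        have hi' : i ∈ (S α).verts ∧ i ∉ K α := by
          by_contra hc
          exact hi ⟨by tauto, hiA⟩
        exact hj.2 (h.boundary_hub hα hi'.1 hi'.2 hj.1 hij))
    have hKA : setSum (K α \ A α) d = 0 := by
      rw [← hb]
      congr 1
      ext j
      simp only [Set.mem_sdiff, Set.mem_inter_iff, SimpleGraph.Subgraph.mem_neighborSet,
        h.adj_hub hα hpA, Set.mem_ofPred_eq]
      constructor
      · rintro ⟨hjK, hjA⟩
        exact ⟨⟨hmax.subset_verts hjK, fun e => hjA (e ▸ hpA)⟩, Or.inr hjK, hjA⟩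
      · rintro ⟨⟨hj, -⟩, hj' | hj', hjA⟩
        exacts [absurd hj hj', ⟨hj', hjA⟩]
    have hD : setSum (K α) d = 0 := by
      rw [← setSum_diff_add hAK, hKA, setSum_eq_zero h0, add_zero]
    have hoK := h.hub_center_subset hα
    have hz : ∀ j ∈ K α, j ∉ A o → d j = 0 := by
      intro j hj hjo
      by_cases hjA : j ∈ A α
      · exact h0 j hjA
      · refine hd.eq_zero_of_notMem_hub h (h.max_center α hα) hD hj hjo fun β hβ hjβ => hjA ?_
        obtain rfl := (h.inter_pair α hα β hβ j (h.subset_verts hα hj)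
          (h.subset_verts hβ (h.hub_subset hβ hjβ))).resolve_right hjo
        exact hjβ
    by_cases hio : i ∈ A o
    · refine hd.eq_zero_of_setSum_eq_zero h.hub_center_subset_verts
        (fun i hi j => h.adj_hub_center hi) (Or.inl ?_) i hio
      have hz' : setSum (K α \ A o) d = 0 := setSum_eq_zero fun j hj => hz j hj.1 hj.2
      rw [← hD, ← setSum_diff_add hoK, hz', zero_add]
    · exact hz i hiL hio
  · by_cases hiA : i ∈ A α
    · exact h0 i hiA
    have hW : ∀ i ∈ L \ A α, ∀ j, G.Adj i j ↔ j ∈ L ∧ j ≠ i := fun i hi j =>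
      h.adj_clique hα hL hne hi.1 hi.2
    -- A clique other than `K α` is attached to the rest of `G` only through `A α`, so `L \ A α` is
    -- itself a branch.
    refine hd.eq_zero_of_setSum_eq_zero Set.sdiff_subset hW (Or.inl ?_) i ⟨hiL, hiA⟩
    rw [← hd.branch p hpP (L \ A α) (fun hc => hc.2 hpA) (h0 p hpA)]
    · congr 1
      refine (Set.inter_eq_right.2 fun j hj => ?_).symm
      exact ((hW j hj p).2 ⟨hAL hpA, fun e => hj.2 (e ▸ hpA)⟩).symm
    · intro i hi j hj hij
      have hiL := ((hW j hj i).1 hij.symm).1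
      exact h0 i (by_contra fun hc => hi ⟨hiL, hc⟩)

lemma eq_zero_of_all_center (hd : IsRigid G P d) (h : HubGluing G S A K o E)
    (hP : ∃ p ∈ A o, p ∈ P) (hPE : ∀ α ∈ E, ∃ p ∈ A α, p ∈ P)
    (h0 : ∀ i ∈ A o, d i = 0) (i : V) : d i = 0 := by
  rcases h.mem_verts i with hi | ⟨α, hα, hi⟩
  · obtain ⟨L, hL, hiL⟩ := exists_isMaxCliqueOf_of_mem hi
    exact hd.eq_zero_of_center h hP h0 hL i hiL
  · exact hd.eq_zero_of_hub h hα (hPE α hα) (fun j hj =>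
      hd.eq_zero_of_center h hP h0 (h.max_center α hα) j (h.hub_subset hα hj)) i hi

/-- A rigid difference that vanishes at one admissible vertex of `S o` vanishes. -/
theorem eq_zero (hd : IsRigid G P d) (h : HubGluing G S A K o E)
    (hP : ∃ p ∈ A o, p ∈ P) (hPE : ∀ α ∈ E, ∃ p ∈ A α, p ∈ P)
    (hL : IsMaxCliqueOf (S o) L) {v : V} (hv : v ∈ L) (hvP : v ∈ P) (hv0 : d v = 0) (i : V) :
    d i = 0 := by
  have of_hub : ∀ α ∈ E, (∀ j ∈ A α, d j = 0) → d i = 0 := fun α hα hz =>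
    hd.eq_zero_of_all_center h hP hPE (fun j hj => hd.eq_zero_of_hub h hα (hPE α hα) hz j
      (h.subset_verts hα (h.hub_center_subset hα hj))) i
  by_cases hvo : v ∈ A o
  · refine hd.eq_zero_of_all_center h hP hPE ?_ i
    exact hd.eq_zero_of_setSum_eq_zero h.hub_center_subset_verts
      (fun i hi j => h.adj_hub_center hi) (Or.inr (hd.setSum_eq_zero_of_eq_zero hvP
        (h.hub_center_subset_verts hvo) (fun j => h.adj_hub_center hvo) hv0))
  by_cases hvE : ∃ α ∈ E, v ∈ A α
  · obtain ⟨α, hα, hvα⟩ := hvE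
    have hV := h.hub_subset hα |>.trans (h.subset_verts hα)
    exact of_hub α hα (hd.eq_zero_of_setSum_eq_zero hV (fun i hi j => h.adj_hub hα hi)
      (Or.inr (hd.setSum_eq_zero_of_eq_zero hvP (hV hvα) (fun j => h.adj_hub hα hvα) hv0)))
  push Not at hvE
  have hD : setSum L d = 0 := hd.setSum_eq_zero_of_eq_zero hvP hv
    (fun j => h.adj_clique_center hL hv hvo hvE) hv0
  have hoL : A o ⊆ L := h.hub_center.subset hL
  refine hd.eq_zero_of_all_center h hP hPE ?_ i
  refine hd.eq_zero_of_setSum_eq_zero h.hub_center_subset_verts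
    (fun i hi j => h.adj_hub_center hi) (Or.inl ?_)
  by_cases hE : ∃ α ∈ E, K α = L
  · obtain ⟨α, hα, rfl⟩ := hE
    have hAK := h.hub_subset hα
    have hAo : A α ⊆ K α \ A o := fun j hj => ⟨hAK hj, h.notMem_hub α hα j hj⟩
    -- Outside `A o` the clique `K α` meets no other `S β`, so its remaining vertices lie in no hub.
    have hz : setSum ((K α \ A o) \ A α) d = 0 := by
      refine setSum_eq_zero fun j hj => ?_
      refine hd.eq_zero_of_notMem_hub h hL hD hj.1.1 hj.1.2 fun β hβ hjβ => hj.2 ?_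
      obtain rfl := (h.inter_pair α hα β hβ j (h.subset_verts hα hj.1.1)
        (h.subset_verts hβ (h.hub_subset hβ hjβ))).resolve_right hj.1.2
      exact hjβ
    have hsum : setSum (A α) d + setSum (A o) d = 0 := by
      rw [← hD, ← setSum_diff_add hoL, ← setSum_diff_add hAo, hz, zero_add]
    have hKA : setSum (K α \ A α) d = setSum (A o) d := by
      have := setSum_diff_add hAK d
      rw [hD, ← hsum, add_comm] at this
      exact add_left_cancel this
    have hAQ : A α ⊆ {j | (j ∈ (S α).verts ∧ j ∉ K α) ∨ j ∈ A α} := fun j hj => Or.inr hj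
    -- Edges leave this set exactly from `A α` to `K α \ A α`, over which `d` has opposite sums.
    have hc := hd.cut {j | (j ∈ (S α).verts ∧ j ∉ K α) ∨ j ∈ A α}
    rw [cutSum_eq_inner (t := K α \ A α) hAQ, hKA,
      eq_neg_of_add_eq_zero_left hsum, inner_neg_left, real_inner_self_eq_norm_sq] at hc
    · exact norm_eq_zero.1 (pow_eq_zero_iff two_ne_zero |>.1
        (le_antisymm (by linarith) (sq_nonneg _)))
    · refine Set.disjoint_left.2 fun j hj hj' => ?_
      exact hj'.elim (fun h' => h'.2 hj.1) hj.2
    · intro i hi j hj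
      have hjA : j ∉ A α := fun hc => hj (Or.inr hc)
      have hj' : j ∉ (S α).verts ∨ j ∈ K α := by
        by_contra hc
        exact hj (Or.inl (by tauto))
      constructor
      · intro hij
        have hiA : i ∈ A α := by
          rcases hi with hi | hi
          · exact absurd (h.boundary_hub hα hi.1 hi.2 hj' hij) hjA
          · exact hi
        exact ⟨hiA, hj'.resolve_left fun hc => hc ((h.adj_hub hα hiA).1 hij).1, hjA⟩
      · rintro ⟨hiA, hjK⟩
        exact (h.adj_hub hα hiA).2 ⟨h.subset_verts hα hjK.1, fun e => hjA (e ▸ hiA)⟩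
  · push Not at hE
    have hz : setSum (L \ A o) d = 0 := setSum_eq_zero fun j hj =>
      hd.eq_zero_of_notMem_hub h hL hD hj.1 hj.2 fun α hα hjα => hE α hα
        (h.eq_clique hα hL hj.1 hj.2 (h.subset_verts hα (h.hub_subset hα hjα)))
    rw [← hD, ← setSum_diff_add hoL, hz, zero_add]

end IsRigid

/-! ### From rigidity to a measurable map. -/

section Main

variable {V : Type*} [Fintype V] {n : ℕ}

/-- By the Lusin–Souslin theorem an injective Borel map on a Borel set is a measurable embedding, so
its inverse extends measurably, here by a constant point of the product. -/
lemma concentratedOnMap_of_injOn {X : V → Set (EuclideanSpace ℝ (Fin n))}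
    (hX : ∀ i, (X i).Nonempty) {v : V} {γ : Measure (V → EuclideanSpace ℝ (Fin n))}
    {s : Set (V → EuclideanSpace ℝ (Fin n))} (hs : MeasurableSet s) (hsX : s ⊆ Set.univ.pi X)
    (hγ : ∀ᵐ x ∂γ, x ∈ s) (hinj : Set.InjOn (fun x => x v) s) : ConcentratedOnMap X v γ := by
  classical
  choose c hc using hX
  have := hs.standardBorel
  let f : s → EuclideanSpace ℝ (Fin n) := fun x => x.1 v
  let g : s → {i : V // i ≠ v} → EuclideanSpace ℝ (Fin n) := fun x i => x.1 i
  have hf : Measurable f := (measurable_pi_apply v).comp measurable_subtype_coe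
  have hg : Measurable g :=
    measurable_pi_lambda _ fun i => (measurable_pi_apply _).comp measurable_subtype_coe
  have hfi : Function.Injective f := fun x y h => Subtype.ext (hinj x.2 y.2 h)
  have hfe : MeasurableEmbedding f := hf.measurableEmbedding hfi
  refine ⟨Function.extend f g fun _ i => c i, hfe.measurable_extend hg measurable_const, ?_, ?_⟩
  · intro y _ i
    by_cases hy : ∃ x, f x = y
    · obtain ⟨x, rfl⟩ := hy
      rw [hfi.extend_apply]
      exact hsX x.2 i trivial
    · rw [Function.extend_apply' _ _ _ hy]
      exact hc i
  · filter_upwards [hγ] with x hx i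
    have := hfi.extend_apply g (fun _ i => c i) ⟨x, hx⟩
    exact (congrFun this i).symm

/-- A Kantorovich solution is concentrated on a Borel subset of the product, any two elements of
which have a rigid difference. -/
theorem IsKantorovichSolution.exists_isRigid {X : V → Set (EuclideanSpace ℝ (Fin n))}
    (hX : ∀ i, MeasurableSet (X i)) (hXbdd : ∀ i, Bornology.IsBounded (X i))
    {μ : V → Measure (EuclideanSpace ℝ (Fin n))} (hμX : ∀ i, μ i (X i)ᶜ = 0)
    {G : Graph V} {γ : Measure (V → EuclideanSpace ℝ (Fin n))}
    (hγ : IsKantorovichSolution X μ (surplus G) γ) :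
    ∃ s : Set (V → EuclideanSpace ℝ (Fin n)), MeasurableSet s ∧ s ⊆ Set.univ.pi X ∧
      (∀ᵐ x ∂γ, x ∈ s) ∧ ∀ x ∈ s, ∀ y ∈ s, IsRigid G {p | μ p ≪ volume} (x - y) := by
  let Γ := γ.support ∩ Set.univ.pi X
  have hΓ : RearrangementMonotone (surplus G) Γ :=
    (hγ.rearrangementMonotone_support hX hXbdd hμX (continuous_surplus G)).mono
      Set.inter_subset_left
  have hΓb : Bornology.IsBounded Γ := (Bornology.IsBounded.pi hXbdd).subset Set.inter_subset_right
  have hN : ∀ (p : V) (B : Set V), ∃ N : Set (EuclideanSpace ℝ (Fin n)), volume N = 0 ∧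
      (p ∉ B → ∀ x ∈ Γ, ∀ y ∈ Γ, x p ∉ N → x p = y p →
        (∀ i ∉ B, ∀ j ∈ B, G.Adj i j → x i = y i) →
          setSum (G.neighborSet p ∩ B) (x - y) = 0) := by
    intro p B
    by_cases hp : p ∈ B
    · exact ⟨∅, measure_empty, fun h => absurd hp h⟩
    · obtain ⟨N, hN, h⟩ := hΓ.exists_null_set hΓb hp
      exact ⟨N, hN, fun _ => h⟩
  choose N hN0 hN using hN
  -- There are finitely many pairs `(p, B)`, so all exceptional null sets can be discarded at once;
  -- `toMeasurable` keeps the remaining set Borel.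
  let D : V → Set V → Set (V → EuclideanSpace ℝ (Fin n)) :=
    fun p B => (fun x => x p) ⁻¹' (toMeasurable volume (N p B))ᶜ
  refine ⟨Γ ∩ ⋂ p ∈ {p | μ p ≪ volume}, ⋂ B, D p B, ?_, ?_, ?_, ?_⟩
  · refine (Measure.isClosed_support.measurableSet.inter (MeasurableSet.univ_pi hX)).inter ?_
    exact MeasurableSet.biInter (Set.to_countable _) fun p _ => MeasurableSet.iInter fun B =>
      measurable_pi_apply p (measurableSet_toMeasurable _ _).compl
  · exact fun x hx => hx.1.2
  · have h1 : ∀ᵐ x ∂γ, x ∈ γ.support := Measure.support_mem_ae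
    have h2 : ∀ᵐ x ∂γ, x ∈ Set.univ.pi X := hγ.1.concentrated
    have h3 : ∀ᵐ x ∂γ, ∀ p ∈ {p | μ p ≪ volume}, ∀ B, x ∈ D p B := by
      refine (ae_ball_iff (Set.to_countable _)).2 fun p hp => ae_all_iff.2 fun B => ?_
      have h0 : μ p (toMeasurable volume (N p B)) = 0 := hp (by rw [measure_toMeasurable, hN0])
      rw [← hγ.1.marginal p,
        Measure.map_apply (measurable_pi_apply p) (measurableSet_toMeasurable _ _)] at h0
      exact measure_eq_zero_iff_ae_notMem.1 h0
    filter_upwards [h1, h2, h3] with x hx1 hx2 hx3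
    exact ⟨⟨hx1, hx2⟩, Set.mem_iInter₂.2 fun p hp => Set.mem_iInter.2 fun B => hx3 p hp B⟩
  · intro x hx y hy
    refine ⟨hΓ.cutSum_nonneg hx.1 hy.1, fun p hp B hpB h0 hb => ?_⟩
    refine hN p B hpB x hx.1 y hy.1 ?_ (sub_eq_zero.1 h0)
      fun i hi j hj hij => sub_eq_zero.1 (hb i hi j hj hij)
    exact fun hxN => Set.mem_iInter.1 (Set.mem_iInter₂.1 hx.2 p hp) B (subset_toMeasurable _ _ hxN)

end Main

end GraphOT

/-- The maximal cliques of `S 0` are listed as `C 0, ..., C (l - 1)` (indices start at `0`). -/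
theorem proposition4p2 {V : Type*} [Fintype V] {n l : ℕ} [NeZero l]
    (X : V → Set (EuclideanSpace ℝ (Fin n)))
    (hXopen : ∀ i, IsOpen (X i)) (hXbdd : ∀ i, Bornology.IsBounded (X i))
    (μ : V → Measure (EuclideanSpace ℝ (Fin n))) (hμ : ∀ i, IsProbabilityMeasure (μ i))
    (hμX : ∀ i, μ i (X i)ᶜ = 0)
    (S : Fin l → GraphOT.Graph V) (A : Fin l → Set V) (C : Fin l → Set V)
    (hC : Set.range C = {K | GraphOT.IsMaxCliqueOf (S 0) K})
    (E : Finset (Fin l)) (hE : 0 ∉ E)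
    (hhub₁ : GraphOT.IsInnerHub (S 0) (A 0))
    (hhub : ∀ α ∈ E, GraphOT.IsInnerHub (S α) (A α))
    (hAne : ∀ α ∈ E, (A α).Nonempty)
    (hAdisj : ∀ α ∈ E, A α ∩ A 0 = ∅)
    (G : GraphOT.Graph V) (hG : G = ⨆ α ∈ insert 0 E, S α) (hGV : G.verts = Set.univ)
    (hglue : ∀ α ∈ E, GraphOT.GluedOnClique (S α) (S 0))
    (hinter : ∀ α ∈ E, ∀ β ∈ E, α ≠ β → (S α).verts ∩ (S β).verts = A 0)
    (hac : ∀ α ∈ insert 0 E, ∃ p ∈ A α, μ p ≪ volume)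
    (v₁ : V) (hv₁ : v₁ ∈ C 0) (hac₁ : μ v₁ ≪ volume)
    (γ : Measure (V → EuclideanSpace ℝ (Fin n)))
    (hγ : GraphOT.IsKantorovichSolution X μ (GraphOT.surplus G) γ) :
    GraphOT.ConcentratedOnMap X v₁ γ := by
  choose K hK using fun α : E => hglue α α.2
  let K' : Fin l → Set V := fun α => if hα : α ∈ E then K ⟨α, hα⟩ else ∅
  have hK' : ∀ α ∈ E, GraphOT.IsMaxCliqueOf (S α) (K' α) ∧ GraphOT.IsMaxCliqueOf (S 0) (K' α) ∧
      (S α).verts ∩ (S 0).verts = K' α := by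
    intro α hα
    simp only [K', dif_pos hα]
    exact hK ⟨α, hα⟩
  have h : GraphOT.HubGluing G S A K' 0 E :=
    { adj_iff := fun i j => by simp [hG]
      mem_verts := fun i => by
        have hi : i ∈ G.verts := hGV ▸ Set.mem_univ i
        simpa [hG] using hi
      hub_center := hhub₁
      hub := hhub
      notMem_hub := fun α hα i hi hi0 => (hAdisj α hα).subset ⟨hi, hi0⟩
      max := fun α hα => (hK' α hα).1
      max_center := fun α hα => (hK' α hα).2.1
      inter := fun α hα i hi hi0 => (hK' α hα).2.2 ▸ ⟨hi, hi0⟩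
      inter_pair := fun α hα β hβ i hi hi' =>
        or_iff_not_imp_left.2 fun hne => hinter α hα β hβ hne ▸ ⟨hi, hi'⟩ }
  have hL : GraphOT.IsMaxCliqueOf (S 0) (C 0) := hC.subset (Set.mem_range_self 0)
  obtain ⟨s, hs, hsX, hγs, hrig⟩ := hγ.exists_isRigid (fun i => (hXopen i).measurableSet) hXbdd hμX
  refine GraphOT.concentratedOnMap_of_injOn (fun i => ?_) hs hsX hγs fun x hx y hy hxy => ?_
  · have := hμ i
    rw [Set.nonempty_iff_ne_empty]
    intro he
    simpa [he] using hμX i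
  · refine sub_eq_zero.1 (funext fun i => ?_)
    exact (hrig x hx y hy).eq_zero h (hac 0 (Finset.mem_insert_self 0 E))
      (fun α hα => hac α (Finset.mem_insert_of_mem hα)) hL hv₁ hac₁ (sub_eq_zero.2 hxy) i
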